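/- Let $b\ge 2$ be an integer and $0<\alpha<1$. Let $\mathbb S^1=\mathbb R/\mathbb Z$ with the arc-length metric $|x-y|=\min_{n\in\mathbb Z}|x-y+n|$. For a Lipschitz function $g\colon\mathbb S^1\to\mathbb R$ put $W_g^{\alpha,b}(x)=\sum_{k=0}^\infty b^{-\alpha k}g(b^kx)$, and let $\mathcal W^{\alpha,b}$ be the set of all functions $W_g^{\alpha,b}$ with $g$ Lipschitz. For a finite collection $\mathcal G=\{g_0,\dots,g_{d-1}\}$ of Lipschitz functions on $\mathbb S^1$ let $\Phi_{\mathcal G}^{\alpha,b}=(W_{g_0}^{\alpha,b},\dots,W_{g_{d-1}}^{\alpha,b})\colon\mathbb S^1\to\mathbb R^d$. A map $\Phi\colon\mathbb S^1\to\mathbb R^d$ is called $\alpha$-bi-Hölder if there are constants $c_1,c_2>0$ such that $c_1\le \|\Phi(x)-\Phi(y)\|_\infty/|x-y|^\alpha\le c_2$ for all $x\ne y$ in $\mathbb S^1$. Then there exist $d$ and $\mathcal G$ as above for which $\Phi_{\mathcal G}^{\alpha,b}$ is $\alpha$-bi-Hölder. Moreover, for every $d$ and every such $\mathcal G=\{g_0,\dots,g_{d-1}\}$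 for which $\Phi=\Phi_{\mathcal G}^{\alpha,b}$ is $\alpha$-bi-Hölder, and for every $W\in\mathcal W^{\alpha,b}$, for Lebesgue-almost every $\mathbf t\in\mathbb R^d$ the occupation measure $\lambda_{\mathbf t}=(W_{\mathbf t})_*\mathcal L^1$ of the function $W_{\mathbf t}(x)=W(x)+\langle\mathbf t,\Phi(x)\rangle$, where $\mathcal L^1$ is the Lebesgue measure on $\mathbb S^1$ (of total mass one), is absolutely continuous with respect to the Lebesgue measure on $\mathbb R$, with density in $L^2(\mathbb R)$. -/

import Mathlib

open MeasureTheory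

noncomputable section

/-- The Weierstrass function `W_g^{α,b}(x) = ∑_{k ≥ 0} b^{-αk} g(b^k x)` on the circle `ℝ/ℤ`.
For bounded `g` (in particular Lipschitz `g`), `α > 0` and `b ≥ 2` the series converges
absolutely. -/
def weierstrass (α : ℝ) (b : ℕ) (g : UnitAddCircle → ℝ) (x : UnitAddCircle) : ℝ :=
  ∑' k : ℕ, (b : ℝ) ^ (-(α * (k : ℝ))) * g ((b ^ k) • x)

/-- A Lipschitz function on the circle `ℝ/ℤ` (with its arc-length metric). -/
def IsLipschitzOnCircle (g : UnitAddCircle → ℝ) : Prop :=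
  ∃ K : NNReal, LipschitzWith K g

/-- The family `𝒲^{α,b}` of all Weierstrass functions of Lipschitz functions on the circle. -/
def weierstrassFamily (α : ℝ) (b : ℕ) : Set (UnitAddCircle → ℝ) :=
  {W | ∃ g : UnitAddCircle → ℝ, IsLipschitzOnCircle g ∧ W = weierstrass α b g}

/-- The Weierstrass map `Φ_G^{α,b} = (W_{g_0}, …, W_{g_{d-1}}) : ℝ/ℤ → ℝ^d`. -/
def weierstrassEmbedding (α : ℝ) (b : ℕ) {d : ℕ} (G : Fin d → UnitAddCircle → ℝ)
    (x : UnitAddCircle) : Fin d → ℝ :=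
  fun i => weierstrass α b (G i) x

/-- `Φ : ℝ/ℤ → ℝ^d` is `α`-bi-Hölder; the norm on `Fin d → ℝ` is the `ℓ^∞` norm and `dist` is the
arc-length distance on the circle. -/
def IsBiHolder (α : ℝ) {d : ℕ} (Φ : UnitAddCircle → Fin d → ℝ) : Prop :=
  ∃ c₁ c₂ : ℝ, 0 < c₁ ∧ 0 < c₂ ∧ ∀ x y : UnitAddCircle, x ≠ y →
    c₁ ≤ ‖Φ x - Φ y‖ / dist x y ^ α ∧ ‖Φ x - Φ y‖ / dist x y ^ α ≤ c₂

/-- The perturbation `W_t(x) = W(x) + ⟨t, Φ(x)⟩`. -/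
def perturbed {d : ℕ} (W : UnitAddCircle → ℝ) (Φ : UnitAddCircle → Fin d → ℝ) (t : Fin d → ℝ)
    (x : UnitAddCircle) : ℝ :=
  W x + t ⬝ᵥ Φ x

/-- The occupation measure of `f : ℝ/ℤ → ℝ`: the pushforward under `f` of the Lebesgue measure on
the circle (of total mass one). -/
def occupationMeasure (f : UnitAddCircle → ℝ) : Measure ℝ :=
  (volume : Measure UnitAddCircle).map f

/-- `μ` is absolutely continuous with respect to the Lebesgue measure on `ℝ`, and its density
belongs to `L²(ℝ)`. -/
def IsACWithL2Density (μ : Measure ℝ) : Prop :=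
  μ ≪ volume ∧ MemLp (fun y : ℝ => (μ.rnDeriv volume y).toReal) 2 volume

end

/-!
Let `μ_t` be the occupation measure of `W + ⟨t, Φ⟩`. It has an `L²` density as soon as
`(2r)⁻¹ (𝓛 ⊗ 𝓛) {(x, y) | |W_t x - W_t y| ≤ r}` does not tend to infinity as `r → 0`. For fixed
`x ≠ y` the parameters `t` of a ball with `|W_t x - W_t y| ≤ r` form a slab of width at most
`2r / ‖Φ x - Φ y‖`, so the integral of this quantity over the ball is bounded, uniformly in `r`, by
a multiple of `∬ ‖Φ x - Φ y‖⁻¹`. The lower Hölder bound compares the latter to `∬ |x - y| ^ (-α)`,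
which is finite because `α < 1`; Fatou's lemma concludes.

For the existence of a bi-Hölder map, the upper bound holds for every Lipschitz family. For the
lower bound at distance `s`, choose `m` so that `b ^ m * s` is a small constant and let `g` be a
sawtooth that falls with slope `-1` and rises by almost `1` between `b ^ m * x` and
`b ^ m * (x + s)`. The term of order `m` then contributes about `b ^ (-α * m)` to
`W_g (x + s) - W_g x`, while the one-sided bound on the falls of `g` keeps the negative contribution
of the other terms below a small multiple of that. As the rise of `g` is shorter than `b ^ m * s`,
finitely many translates of one sawtooth suffice. Points at distance bounded below are separated by
finitely many distance functions, each of which is a Weierstrass function, since `h = W_g` for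
`g x = h x - b ^ (-α) * h (b * x)`.
-/

section Density

open Filter Topology Metric

variable {X : Type*} [MetricSpace X] [MeasurableSpace X] [BorelSpace X]
  [SecondCountableTopology X]

theorem measurable_measure_closedBall (μ : Measure X) [SFinite μ] (r : ℝ) :
    Measurable fun x => μ (closedBall x r) :=
  measurable_measure_prodMk_right (measurableSet_le measurable_dist measurable_const)

/-- The `μ`-average of the density of `μ` relative to `ν` at scale `r`. For `ν` the Lebesgue measure
on `ℝ` it is `(μ ⊗ μ) {(x, y) | |x - y| ≤ r} / (2 r)`. -/
noncomputable def averageDensity (μ ν : Measure X) (r : ℝ) : ENNReal :=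
  ∫⁻ x, μ (closedBall x r) / ν (closedBall x r) ∂μ

theorem lintegral_liminf_density_le (μ ν : Measure X) [SFinite μ] [SFinite ν] (r : ℕ → ℝ) :
    ∫⁻ x, liminf (fun n => μ (closedBall x (r n)) / ν (closedBall x (r n))) atTop ∂μ ≤
      liminf (fun n => averageDensity μ ν (r n)) atTop :=
  lintegral_liminf_le fun _ =>
    (measurable_measure_closedBall μ _).div (measurable_measure_closedBall ν _)

variable [HasBesicovitchCovering X] {μ ν : Measure X} [IsLocallyFiniteMeasure μ]
  [IsLocallyFiniteMeasure ν] {r : ℕ → ℝ}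

theorem absolutelyContinuous_of_ae_liminf_density_lt_top (hr : Tendsto r atTop (𝓝[>] 0))
    (h : ∀ᵐ x ∂μ, liminf (fun n => μ (closedBall x (r n)) / ν (closedBall x (r n))) atTop < ⊤) :
    μ ≪ ν := by
  refine .mk fun A _ hA => ?_
  let bounded (k : ℕ) : Set X :=
    {x ∈ A | ∃ᶠ n in atTop, μ (closedBall x (r n)) ≤ k * ν (closedBall x (r n))}
  have measure_bounded (k : ℕ) : μ (bounded k) = 0 := by
    have hle : μ (bounded k) ≤ ((k : NNReal) • ν) (bounded k) := by
      refine (Besicovitch.vitaliFamily μ).measure_le_of_frequently_le _ .rfl _ fun x hx => ?_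
      exact ((Besicovitch.tendsto_filterAt μ x).comp hr).frequently
        (hx.2.mono fun n hn => by simpa using hn)
    have hν : ν (bounded k) = 0 := measure_mono_null (fun x hx => hx.1) hA
    simpa [hν] using hle
  have hA' : ∀ᵐ x ∂μ, x ∉ A := by
    filter_upwards [h, ae_all_iff.2 fun k => measure_eq_zero_iff_ae_notMem.1 (measure_bounded k)]
      with x hx hxk hxA
    obtain ⟨k, hk⟩ := ENNReal.exists_nat_gt hx.ne
    refine hxk k ⟨hxA, (frequently_lt_of_liminf_lt (by isBoundedDefault) hk).mono fun n hn => ?_⟩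
    exact (ENNReal.div_le_iff_le_mul (.inr (ENNReal.natCast_ne_top k)) (.inr (ne_bot_of_gt hn))).1
      hn.le
  exact measure_eq_zero_iff_ae_notMem.2 hA'

theorem lintegral_rnDeriv_sq_le_liminf_averageDensity (hμν : μ ≪ ν)
    (hr : Tendsto r atTop (𝓝[>] 0)) :
    ∫⁻ x, μ.rnDeriv ν x ^ 2 ∂ν ≤ liminf (fun n => averageDensity μ ν (r n)) atTop := by
  calc ∫⁻ x, μ.rnDeriv ν x ^ 2 ∂ν
      = ∫⁻ x, μ.rnDeriv ν x ∂μ := by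
        simp_rw [sq]
        exact lintegral_rnDeriv_mul hμν (μ.measurable_rnDeriv ν).aemeasurable
    _ = ∫⁻ x, liminf (fun n => μ (closedBall x (r n)) / ν (closedBall x (r n))) atTop ∂μ :=
        lintegral_congr_ae <| hμν.ae_le <| (Besicovitch.ae_tendsto_rnDeriv μ ν).mono
          fun x hx => (hx.comp hr).liminf_eq.symm
    _ ≤ liminf (fun n => averageDensity μ ν (r n)) atTop := lintegral_liminf_density_le μ ν r

theorem absolutelyContinuous_of_liminf_averageDensity_lt_top (hr : Tendsto r atTop (𝓝[>] 0))
    (h : liminf (fun n => averageDensity μ ν (r n)) atTop < ⊤) : μ ≪ ν := by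
  refine absolutelyContinuous_of_ae_liminf_density_lt_top hr (ae_lt_top ?_ ?_)
  · exact .liminf fun n =>
      (measurable_measure_closedBall μ _).div (measurable_measure_closedBall ν _)
  · exact ((lintegral_liminf_density_le μ ν r).trans_lt h).ne

theorem isACWithL2Density_of_liminf_averageDensity_lt_top {μ : Measure ℝ}
    [IsLocallyFiniteMeasure μ] (hr : Tendsto r atTop (𝓝[>] 0))
    (h : liminf (fun n => averageDensity μ volume (r n)) atTop < ⊤) : IsACWithL2Density μ := by
  have hac : μ ≪ volume := absolutelyContinuous_of_liminf_averageDensity_lt_top hr h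
  refine ⟨hac, (μ.measurable_rnDeriv volume).ennreal_toReal.aestronglyMeasurable, ?_⟩
  rw [eLpNorm_lt_top_iff_lintegral_rpow_enorm_lt_top (by norm_num) (by norm_num)]
  refine lt_of_le_of_lt (lintegral_mono fun y => ?_)
    ((lintegral_rnDeriv_sq_le_liminf_averageDensity hac hr).trans_lt h)
  rw [ENNReal.toReal_ofNat, ENNReal.rpow_two, Real.enorm_of_nonneg ENNReal.toReal_nonneg]
  gcongr
  exact ENNReal.ofReal_toReal_le

end Density

section Transversality

open Filter Topology Metric

theorem volume_abs_add_mul_le (c m r : ℝ) (hm : m ≠ 0) :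
    volume {z : ℝ | |c + z * m| ≤ r} ≤ ENNReal.ofReal (2 * r) * ‖m‖ₑ⁻¹ := by
  have hset : {z : ℝ | |c + z * m| ≤ r} ⊆ closedBall (-c / m) (r / |m|) := fun z hz => by
    rw [mem_closedBall, Real.dist_eq, le_div_iff₀ (abs_pos.2 hm), ← abs_mul, sub_mul,
      div_mul_cancel₀ _ hm, sub_neg_eq_add, add_comm]
    exact hz
  refine (measure_mono hset).trans_eq ?_
  rw [Real.volume_closedBall, ← mul_div_assoc, ENNReal.ofReal_div_of_pos (abs_pos.2 hm),
    Real.enorm_eq_ofReal_abs, div_eq_mul_inv]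

theorem exists_enorm_apply_eq_enorm {n : ℕ} (v : Fin (n + 1) → ℝ) : ∃ i, ‖v i‖ₑ = ‖v‖ₑ := by
  obtain ⟨i, -, hi⟩ := Finset.exists_mem_eq_sup' Finset.univ_nonempty (fun i => ‖v i‖₊)
  refine ⟨i, ?_⟩
  rw [enorm_eq_nnnorm, enorm_eq_nnnorm, Pi.nnnorm_def, ← Finset.sup'_eq_sup Finset.univ_nonempty,
    hi]

theorem volume_slab_inter_closedBall_le_of_ne_zero {n : ℕ} {R : ℝ} (hR : 0 ≤ R) (a r : ℝ)
    {v : Fin (n + 1) → ℝ} {i : Fin (n + 1)} (hvi : v i ≠ 0) :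
    volume ({t | |a + t ⬝ᵥ v| ≤ r} ∩ closedBall 0 R) ≤
      ENNReal.ofReal (2 * r) * ‖v i‖ₑ⁻¹ * ENNReal.ofReal ((2 * R) ^ n) := by
  let c (w : Fin n → ℝ) : ℝ := a + ∑ j, w j * v (i.succAbove j)
  let S : Set (ℝ × (Fin n → ℝ)) := {p | |c p.2 + p.1 * v i| ≤ r} ∩ {p | p.2 ∈ closedBall 0 R}
  have hS : MeasurableSet S :=
    (measurableSet_le (by fun_prop) measurable_const).inter
      (measurable_snd isClosed_closedBall.measurableSet)
  have hsub : {t | |a + t ⬝ᵥ v| ≤ r} ∩ closedBall 0 R ⊆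
      MeasurableEquiv.piFinSuccAbove (fun _ => ℝ) i ⁻¹' S := by
    rintro t ⟨ht, htR⟩
    refine ⟨?_, ?_⟩
    · have hdot : t ⬝ᵥ v = t i * v i + ∑ j, t (i.succAbove j) * v (i.succAbove j) :=
        Fin.sum_univ_succAbove _ i
      have hslab : |a + t ⬝ᵥ v| ≤ r := ht
      rwa [hdot, add_comm (t i * v i), ← add_assoc] at hslab
    · rw [mem_closedBall_zero_iff] at htR
      exact mem_closedBall_zero_iff.2 <| (pi_norm_le_iff_of_nonneg hR).2 fun j =>
        (norm_le_pi_norm t (i.succAbove j)).trans htR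
  calc volume ({t | |a + t ⬝ᵥ v| ≤ r} ∩ closedBall 0 R)
      ≤ volume S :=
        (measure_mono hsub).trans_eq <|
          (volume_preserving_piFinSuccAbove (fun _ => ℝ) i).measure_preimage hS.nullMeasurableSet
    _ = ∫⁻ w : Fin n → ℝ, volume {z : ℝ | |c w + z * v i| ≤ r ∧ w ∈ closedBall 0 R} := by
        rw [Measure.volume_eq_prod, Measure.prod_apply_symm hS]
        rfl
    _ ≤ ∫⁻ w : Fin n → ℝ,
          (closedBall 0 R).indicator (fun _ => ENNReal.ofReal (2 * r) * ‖v i‖ₑ⁻¹) w := by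
        refine lintegral_mono fun w => ?_
        by_cases hw : w ∈ closedBall 0 R
        · simpa [hw] using volume_abs_add_mul_le (c w) (v i) r hvi
        · simp [hw]
    _ = ENNReal.ofReal (2 * r) * ‖v i‖ₑ⁻¹ * ENNReal.ofReal ((2 * R) ^ n) := by
        rw [lintegral_indicator_const isClosed_closedBall.measurableSet,
          Real.volume_pi_closedBall _ hR, Fintype.card_fin]

theorem volume_slab_inter_closedBall_le {d : ℕ} {R r : ℝ} (hR : 0 < R) (hr : 0 < r) (a : ℝ)
    (v : Fin d → ℝ) :
    volume ({t | |a + t ⬝ᵥ v| ≤ r} ∩ closedBall 0 R) ≤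
      ENNReal.ofReal (2 * r) * ‖v‖ₑ⁻¹ * ENNReal.ofReal ((2 * R) ^ (d - 1)) := by
  rcases eq_or_ne v 0 with rfl | hv
  · have hr' : ENNReal.ofReal (2 * r) ≠ 0 := by simpa using hr
    have hR' : ENNReal.ofReal ((2 * R) ^ (d - 1)) ≠ 0 := by
      rw [ne_eq, ENNReal.ofReal_eq_zero, not_le]
      positivity
    rw [enorm_zero, ENNReal.inv_zero, ENNReal.mul_top hr', ENNReal.top_mul hR']
    exact le_top
  obtain _ | n := d
  · exact absurd (Subsingleton.elim v 0) hv
  obtain ⟨i, hi⟩ := exists_enorm_apply_eq_enorm v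
  have hvi : v i ≠ 0 := by rwa [← enorm_ne_zero, hi, enorm_ne_zero]
  rw [← hi]
  exact volume_slab_inter_closedBall_le_of_ne_zero hR.le a r hvi

variable {X : Type*} [MeasurableSpace X] {μ : Measure X}

theorem averageDensity_map [IsFiniteMeasure μ] {f : X → ℝ} (hf : Measurable f) (r : ℝ) :
    averageDensity (μ.map f) volume r =
      (μ.prod μ) {p | |f p.1 - f p.2| ≤ r} / ENNReal.ofReal (2 * r) := by
  have hset : MeasurableSet {p : X × X | |f p.1 - f p.2| ≤ r} :=
    measurableSet_le (by fun_prop) measurable_const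
  have hball := measurable_measure_closedBall (μ.map f) r
  have hball_comp : Measurable fun x => μ.map f (closedBall (f x) r) := hball.comp hf
  simp only [averageDensity, Real.volume_closedBall, div_eq_mul_inv]
  rw [lintegral_map (hball.mul_const _) hf, lintegral_mul_const _ hball_comp,
    Measure.prod_apply hset]
  simp only [Measure.map_apply hf isClosed_closedBall.measurableSet]
  congr! with x
  ext y
  simp [Real.dist_eq, abs_sub_comm]

variable {d : ℕ} {W : X → ℝ} {Φ : X → Fin d → ℝ}

theorem measurable_perturbation (hW : Measurable W) (hΦ : Measurable Φ) (t : Fin d → ℝ) :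
    Measurable fun x => W x + t ⬝ᵥ Φ x := by
  unfold dotProduct
  fun_prop

theorem measurableSet_abs_perturbation_sub_le (hW : Measurable W) (hΦ : Measurable Φ) (r : ℝ) :
    MeasurableSet {q : (Fin d → ℝ) × X × X |
      |(W q.2.1 + q.1 ⬝ᵥ Φ q.2.1) - (W q.2.2 + q.1 ⬝ᵥ Φ q.2.2)| ≤ r} := by
  unfold dotProduct
  exact measurableSet_le (by fun_prop) measurable_const

variable [IsFiniteMeasure μ]

theorem measurable_averageDensity_perturbation (hW : Measurable W) (hΦ : Measurable Φ) (r : ℝ) :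
    Measurable fun t : Fin d → ℝ => averageDensity (μ.map fun x => W x + t ⬝ᵥ Φ x) volume r := by
  simp only [averageDensity_map (measurable_perturbation hW hΦ _)]
  exact (measurable_measure_prodMk_left
    (measurableSet_abs_perturbation_sub_le hW hΦ r)).div_const _

theorem lintegral_averageDensity_perturbation_le (hW : Measurable W) (hΦ : Measurable Φ) {R r : ℝ}
    (hR : 0 < R) (hr : 0 < r) :
    ∫⁻ t in closedBall (0 : Fin d → ℝ) R,
        averageDensity (μ.map fun x => W x + t ⬝ᵥ Φ x) volume r ≤
      (∫⁻ p, ‖Φ p.1 - Φ p.2‖ₑ⁻¹ ∂μ.prod μ) * ENNReal.ofReal ((2 * R) ^ (d - 1)) := by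
  have hS := measurableSet_abs_perturbation_sub_le hW hΦ r
  have hmeas : Measurable fun t : Fin d → ℝ => (μ.prod μ)
      {p | |(W p.1 + t ⬝ᵥ Φ p.1) - (W p.2 + t ⬝ᵥ Φ p.2)| ≤ r} :=
    measurable_measure_prodMk_left hS
  simp only [averageDensity_map (measurable_perturbation hW hΦ _), div_eq_mul_inv]
  rw [lintegral_mul_const _ hmeas, ← div_eq_mul_inv]
  refine ENNReal.div_le_of_le_mul' ?_
  calc ∫⁻ t in closedBall (0 : Fin d → ℝ) R, (μ.prod μ)
          {p | |(W p.1 + t ⬝ᵥ Φ p.1) - (W p.2 + t ⬝ᵥ Φ p.2)| ≤ r}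
      = ∫⁻ p, volume.restrict (closedBall 0 R) {t : Fin d → ℝ |
          |(W p.1 + t ⬝ᵥ Φ p.1) - (W p.2 + t ⬝ᵥ Φ p.2)| ≤ r} ∂μ.prod μ :=
        (Measure.prod_apply hS).symm.trans (Measure.prod_apply_symm hS)
    _ ≤ ∫⁻ p, ENNReal.ofReal (2 * r) * ‖Φ p.1 - Φ p.2‖ₑ⁻¹ *
          ENNReal.ofReal ((2 * R) ^ (d - 1)) ∂μ.prod μ := by
        refine lintegral_mono fun p => ?_
        rw [Measure.restrict_apply' isClosed_closedBall.measurableSet]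
        simp only [add_sub_add_comm, ← dotProduct_sub]
        exact volume_slab_inter_closedBall_le hR hr _ _
    _ = ENNReal.ofReal (2 * r) * ((∫⁻ p, ‖Φ p.1 - Φ p.2‖ₑ⁻¹ ∂μ.prod μ) *
          ENNReal.ofReal ((2 * R) ^ (d - 1))) := by
        rw [lintegral_mul_const _ (by fun_prop), lintegral_const_mul _ (by fun_prop), mul_assoc]

theorem ae_liminf_averageDensity_perturbation_lt_top (hW : Measurable W) (hΦ : Measurable Φ)
    (henergy : ∫⁻ p, ‖Φ p.1 - Φ p.2‖ₑ⁻¹ ∂μ.prod μ < ⊤) {r : ℕ → ℝ} (hr : ∀ n, 0 < r n) :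
    ∀ᵐ t : Fin d → ℝ,
      liminf (fun n => averageDensity (μ.map fun x => W x + t ⬝ᵥ Φ x) volume (r n)) atTop < ⊤ := by
  have hmeas (n : ℕ) := measurable_averageDensity_perturbation (μ := μ) hW hΦ (r n)
  have hball (m : ℕ) : ∀ᵐ t : Fin d → ℝ, t ∈ closedBall 0 (m + 1 : ℝ) →
      liminf (fun n => averageDensity (μ.map fun x => W x + t ⬝ᵥ Φ x) volume (r n)) atTop < ⊤ := by
    rw [← ae_restrict_iff' isClosed_closedBall.measurableSet]
    have hbound (n : ℕ) := lintegral_averageDensity_perturbation_le (μ := μ) hW hΦ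
      (m.cast_add_one_pos (α := ℝ)) (hr n)
    refine ae_lt_top (.liminf hmeas) (ne_top_of_le_ne_top ?_ (lintegral_liminf_le hmeas))
    refine ne_top_of_le_ne_top ?_
      (liminf_le_of_frequently_le (Frequently.of_forall hbound) (by isBoundedDefault))
    exact (ENNReal.mul_lt_top henergy ENNReal.ofReal_lt_top).ne
  filter_upwards [ae_all_iff.2 hball] with t ht
  obtain ⟨m, hm⟩ := exists_nat_ge ‖t‖
  exact ht m (mem_closedBall_zero_iff.2 (hm.trans (by simp)))

theorem ae_isACWithL2Density_map_perturbation (hW : Measurable W) (hΦ : Measurable Φ)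
    (henergy : ∫⁻ p, ‖Φ p.1 - Φ p.2‖ₑ⁻¹ ∂μ.prod μ < ⊤) :
    ∀ᵐ t : Fin d → ℝ, IsACWithL2Density (μ.map fun x => W x + t ⬝ᵥ Φ x) := by
  have hr (n : ℕ) : (0 : ℝ) < 1 / (n + 1) := Nat.one_div_pos_of_nat
  filter_upwards [ae_liminf_averageDensity_perturbation_lt_top hW hΦ henergy hr] with t ht
  exact isACWithL2Density_of_liminf_averageDensity_lt_top
    (tendsto_nhdsWithin_iff.2 ⟨tendsto_one_div_add_atTop_nhds_zero_nat, .of_forall hr⟩) ht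

end Transversality

section RieszEnergy

theorem continuous_of_dist_le_mul_rpow {X Y : Type*} [PseudoMetricSpace X] [PseudoMetricSpace Y]
    {f : X → Y} {C α : ℝ} (hα : 0 < α) (h : ∀ x y, dist (f x) (f y) ≤ C * dist x y ^ α) :
    Continuous f := by
  have hf : HolderWith C.toNNReal ⟨α, hα.le⟩ f := fun x y => by
    have hpow : edist x y ^ α = ENNReal.ofReal (dist x y ^ α) := by
      rw [edist_dist, ENNReal.ofReal_rpow_of_nonneg dist_nonneg hα.le]
    change edist (f x) (f y) ≤ ENNReal.ofReal C * edist x y ^ α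
    rw [hpow, ← ENNReal.ofReal_mul' (by positivity), edist_dist]
    exact ENNReal.ofReal_le_ofReal (h x y)
  exact hf.continuous hα

theorem lintegral_enorm_rpow_neg_lt_top {α : ℝ} (hα : α < 1) :
    ∫⁻ z : UnitAddCircle, ‖z‖ₑ ^ (-α) < ⊤ := by
  have hint : IntervalIntegrable (fun t : ℝ => |t| ^ (-α)) volume (-2⁻¹) 2⁻¹ := by
    refine intervalIntegrable_of_even (fun t => by rw [abs_neg]) fun t ht => ?_
    refine (intervalIntegral.intervalIntegrable_rpow' (neg_lt_neg hα)).congr fun s hs => ?_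
    rw [Set.uIoc_of_le ht.le] at hs
    simp only [abs_of_pos hs.1]
  rw [← UnitAddCircle.lintegral_preimage (-2⁻¹)]
  have hIoc := (intervalIntegrable_iff_integrableOn_Ioc_of_le (by norm_num)).1 hint
  rw [show (-2⁻¹ : ℝ) + 1 = 2⁻¹ by norm_num]
  refine lt_of_le_of_lt (setLIntegral_mono_ae' measurableSet_Ioc ?_) hIoc.hasFiniteIntegral
  filter_upwards [Measure.ae_ne volume 0] with t ht0 ht
  have hnorm : ‖(t : UnitAddCircle)‖ = |t| := by
    refine (AddCircle.norm_coe_eq_abs_iff _ one_ne_zero).2 ?_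
    rw [abs_one, abs_le]
    constructor <;> linarith [ht.1, ht.2]
  rw [← ofReal_norm, hnorm, ENNReal.ofReal_rpow_of_pos (abs_pos.2 ht0),
    Real.enorm_of_nonneg (by positivity)]

theorem lintegral_enorm_sub_rpow_neg_lt_top {α : ℝ} (hα : α < 1) :
    ∫⁻ p : UnitAddCircle × UnitAddCircle, ‖p.1 - p.2‖ₑ ^ (-α) < ⊤ := by
  rw [Measure.volume_eq_prod, lintegral_prod_symm _ (by fun_prop)]
  have htranslate (y : UnitAddCircle) :
      ∫⁻ x, ‖x - y‖ₑ ^ (-α) = ∫⁻ z : UnitAddCircle, ‖z‖ₑ ^ (-α) :=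
    lintegral_sub_right_eq_self (fun z : UnitAddCircle => ‖z‖ₑ ^ (-α)) y
  simp only [htranslate, lintegral_const]
  exact ENNReal.mul_lt_top (lintegral_enorm_rpow_neg_lt_top hα) (measure_lt_top _ _)

namespace IsBiHolder

variable {α : ℝ} {d : ℕ} {Φ : UnitAddCircle → Fin d → ℝ}

theorem exists_mul_dist_rpow_le (hα : 0 < α) (hΦ : IsBiHolder α Φ) :
    ∃ c > 0, ∀ x y, c * dist x y ^ α ≤ ‖Φ x - Φ y‖ := by
  obtain ⟨c, _, hc, _, h⟩ := hΦ
  refine ⟨c, hc, fun x y => ?_⟩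
  rcases eq_or_ne x y with rfl | hxy
  · simp [Real.zero_rpow hα.ne']
  · exact (le_div_iff₀ (Real.rpow_pos_of_pos (dist_pos.2 hxy) α)).1 (h x y hxy).1

theorem exists_le_mul_dist_rpow (hΦ : IsBiHolder α Φ) :
    ∃ C, ∀ x y, ‖Φ x - Φ y‖ ≤ C * dist x y ^ α := by
  obtain ⟨_, C, _, hC, h⟩ := hΦ
  refine ⟨C, fun x y => ?_⟩
  rcases eq_or_ne x y with rfl | hxy
  · simpa using by positivity
  · exact (div_le_iff₀ (Real.rpow_pos_of_pos (dist_pos.2 hxy) α)).1 (h x y hxy).2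

theorem continuous (hα : 0 < α) (hΦ : IsBiHolder α Φ) : Continuous Φ := by
  obtain ⟨C, h⟩ := hΦ.exists_le_mul_dist_rpow
  exact continuous_of_dist_le_mul_rpow hα (C := C) fun x y => by
    simpa only [dist_eq_norm] using h x y

theorem lintegral_enorm_sub_inv_lt_top (hα₀ : 0 < α) (hα₁ : α < 1) (hΦ : IsBiHolder α Φ) :
    ∫⁻ p : UnitAddCircle × UnitAddCircle, ‖Φ p.1 - Φ p.2‖ₑ⁻¹ < ⊤ := by
  obtain ⟨c, hc, h⟩ := hΦ.exists_mul_dist_rpow_le hα₀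
  have hlower (x y : UnitAddCircle) : ENNReal.ofReal c * ‖x - y‖ₑ ^ α ≤ ‖Φ x - Φ y‖ₑ := by
    rw [← ofReal_norm (x - y), ← ofReal_norm (Φ x - Φ y),
      ENNReal.ofReal_rpow_of_nonneg (norm_nonneg _) hα₀.le, ← ENNReal.ofReal_mul hc.le]
    exact ENNReal.ofReal_le_ofReal (dist_eq_norm x y ▸ h x y)
  have hc' : ENNReal.ofReal c ≠ 0 := (ENNReal.ofReal_pos.2 hc).ne'
  calc ∫⁻ p : UnitAddCircle × UnitAddCircle, ‖Φ p.1 - Φ p.2‖ₑ⁻¹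
      ≤ ∫⁻ p : UnitAddCircle × UnitAddCircle, (ENNReal.ofReal c)⁻¹ * ‖p.1 - p.2‖ₑ ^ (-α) := by
        refine lintegral_mono fun p => ?_
        rw [ENNReal.rpow_neg, ← ENNReal.mul_inv (.inl hc') (.inl ENNReal.ofReal_ne_top)]
        exact ENNReal.inv_le_inv.2 (hlower p.1 p.2)
    _ = (ENNReal.ofReal c)⁻¹ * ∫⁻ p : UnitAddCircle × UnitAddCircle, ‖p.1 - p.2‖ₑ ^ (-α) :=
        lintegral_const_mul _ (by fun_prop)
    _ < ⊤ := ENNReal.mul_lt_top (by simpa using hc) (lintegral_enorm_sub_rpow_neg_lt_top hα₁)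

theorem ae_isACWithL2Density (hα₀ : 0 < α) (hα₁ : α < 1) (hΦ : IsBiHolder α Φ)
    {W : UnitAddCircle → ℝ} (hW : Measurable W) :
    ∀ᵐ t, IsACWithL2Density (occupationMeasure (perturbed W Φ t)) :=
  ae_isACWithL2Density_map_perturbation hW (hΦ.continuous hα₀).measurable
    (hΦ.lintegral_enorm_sub_inv_lt_top hα₀ hα₁)

end IsBiHolder

end RieszEnergy

section GeometricModulus

/-- The modulus of continuity inherited by `∑ q ^ k * g (B ^ k * x)` from a function `g` whose own
modulus of continuity is `s ↦ min s 1`. -/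
noncomputable def geometricModulus (q B s : ℝ) : ℝ := ∑' k : ℕ, q ^ k * min (B ^ k * s) 1

theorem hasSum_geometricModulus {q B s : ℝ} (hq₀ : 0 ≤ q) (hq₁ : q < 1) (hB : 0 ≤ B)
    (hs : 0 ≤ s) :
    HasSum (fun k : ℕ => q ^ k * min (B ^ k * s) 1) (geometricModulus q B s) :=
  Summable.hasSum <| (summable_geometric_of_lt_one hq₀ hq₁).of_nonneg_of_le
    (fun k => by positivity) fun k => mul_le_of_le_one_right (by positivity) (min_le_right _ _)

theorem geometricModulus_le {q B s : ℝ} (hq₀ : 0 ≤ q) (hq₁ : q < 1) (hB : 0 ≤ B)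
    (hqB : 1 < q * B) (hs : 0 ≤ s) (n : ℕ) :
    geometricModulus q B s ≤ q ^ n * (B ^ n * s / (q * B - 1) + 1 / (1 - q)) := by
  have hsum := (hasSum_geometricModulus hq₀ hq₁ hB hs).summable
  have : 0 < q * B - 1 := sub_pos.2 hqB
  have hcoarse : ∑ k ∈ Finset.range n, q ^ k * min (B ^ k * s) 1 ≤
      q ^ n * (B ^ n * s / (q * B - 1)) :=
    calc ∑ k ∈ Finset.range n, q ^ k * min (B ^ k * s) 1
        ≤ ∑ k ∈ Finset.range n, (q * B) ^ k * s := by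
          refine Finset.sum_le_sum fun k _ => ?_
          rw [mul_pow, mul_assoc]
          gcongr
          exact min_le_left _ _
      _ = ((q * B) ^ n - 1) / (q * B - 1) * s := by rw [← Finset.sum_mul, geom_sum_eq hqB.ne']
      _ ≤ (q * B) ^ n / (q * B - 1) * s := by gcongr; exact sub_le_self _ zero_le_one
      _ = q ^ n * (B ^ n * s / (q * B - 1)) := by ring
  have hfine : ∑' k : ℕ, q ^ (k + n) * min (B ^ (k + n) * s) 1 ≤ q ^ n * (1 / (1 - q)) :=
    calc ∑' k : ℕ, q ^ (k + n) * min (B ^ (k + n) * s) 1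
        ≤ ∑' k : ℕ, q ^ n * q ^ k := by
          refine ((summable_nat_add_iff n).2 hsum).tsum_le_tsum (fun k => ?_)
            ((summable_geometric_of_lt_one hq₀ hq₁).mul_left _)
          rw [← pow_add, add_comm n]
          exact mul_le_of_le_one_right (by positivity) (min_le_right _ _)
      _ = q ^ n * (1 / (1 - q)) := by
          rw [tsum_mul_left, tsum_geometric_of_lt_one hq₀ hq₁, one_div]
  rw [geometricModulus, ← hsum.sum_add_tsum_nat_add n, mul_add]
  exact add_le_add hcoarse hfine

theorem exists_geometricModulus_le_mul_pow {q B : ℝ} (hq₀ : 0 ≤ q) (hq₁ : q < 1) (hB : 0 ≤ B)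
    (hqB : 1 < q * B) {ε : ℝ} (hε : 0 < ε) :
    ∃ δ > 0, ∀ (m : ℕ) (s : ℝ), 0 ≤ s → B ^ m * s ≤ δ → geometricModulus q B s ≤ ε * q ^ m := by
  have hqB' : 0 < q * B - 1 := sub_pos.2 hqB
  have hq₁' : 0 < 1 - q := sub_pos.2 hq₁
  obtain ⟨j, hj⟩ := exists_pow_lt_of_lt_one (y := q) (by positivity : 0 < ε / 2 * (1 - q)) hq₁
  refine ⟨ε / 2 * (q * B - 1) / (q * B) ^ j, by positivity, fun m s hs hδ => ?_⟩
  have hcoarse : (q * B) ^ j * (B ^ m * s) / (q * B - 1) ≤ ε / 2 := by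
    rw [div_le_iff₀ hqB', ← le_div_iff₀' (by positivity)]
    exact hδ
  have hfine : q ^ j / (1 - q) ≤ ε / 2 := (div_le_iff₀ hq₁').2 hj.le
  calc geometricModulus q B s
      ≤ q ^ (m + j) * (B ^ (m + j) * s / (q * B - 1) + 1 / (1 - q)) :=
        geometricModulus_le hq₀ hq₁ hB hqB hs _
    _ = ((q * B) ^ j * (B ^ m * s) / (q * B - 1) + q ^ j / (1 - q)) * q ^ m := by ring
    _ ≤ (ε / 2 + ε / 2) * q ^ m := by gcongr
    _ = ε * q ^ m := by rw [add_halves]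

theorem exists_le_pow_mul_le {B s θ : ℝ} (hB : 1 < B) (hs : 0 < s) (hsθ : s ≤ θ) :
    ∃ m : ℕ, θ ≤ B ^ m * s ∧ B ^ m * s ≤ B * θ := by
  obtain ⟨n, hn, hn'⟩ := exists_nat_pow_near ((one_le_div hs).2 hsθ) hB
  refine ⟨n + 1, ((div_lt_iff₀ hs).1 hn').le, ?_⟩
  rw [le_div_iff₀ hs] at hn
  rw [pow_succ', mul_assoc]
  gcongr

variable {B α s : ℝ}

theorem one_lt_rpow_neg_mul_self (hB : 1 < B) (hα : α < 1) : 1 < B ^ (-α) * B := by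
  rw [← Real.rpow_add_one (by positivity)]
  exact Real.one_lt_rpow hB (by linarith)

theorem rpow_eq_rpow_neg_pow_mul (hB : 0 < B) (α : ℝ) (hs : 0 ≤ s) (m : ℕ) :
    s ^ α = (B ^ (-α)) ^ m * (B ^ m * s) ^ α := by
  rw [Real.mul_rpow (by positivity) hs, ← Real.rpow_pow_comm hB.le, ← mul_assoc, ← mul_pow,
    ← Real.rpow_add hB, neg_add_cancel, Real.rpow_zero, one_pow, one_mul]

theorem exists_geometricModulus_le_mul_rpow (hB : 1 < B) (hα₀ : 0 < α) (hα₁ : α < 1) :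
    ∃ C > 0, ∀ s, 0 < s → s ≤ 1 → geometricModulus (B ^ (-α)) B s ≤ C * s ^ α := by
  have hB₀ : 0 < B := one_pos.trans hB
  have hq₁ : B ^ (-α) < 1 := Real.rpow_lt_one_of_one_lt_of_neg hB (neg_lt_zero.2 hα₀)
  have : 0 < 1 - B ^ (-α) := sub_pos.2 hq₁
  have hqB := one_lt_rpow_neg_mul_self hB hα₁
  have : 0 < B ^ (-α) * B - 1 := sub_pos.2 hqB
  refine ⟨B / (B ^ (-α) * B - 1) + 1 / (1 - B ^ (-α)), by positivity, fun s hs₀ hs₁ => ?_⟩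
  obtain ⟨m, hm, hm'⟩ := exists_le_pow_mul_le hB hs₀ hs₁
  rw [mul_one] at hm'
  calc geometricModulus (B ^ (-α)) B s
      ≤ (B ^ (-α)) ^ m * (B ^ m * s / (B ^ (-α) * B - 1) + 1 / (1 - B ^ (-α))) :=
        geometricModulus_le (by positivity) hq₁ hB₀.le hqB hs₀.le m
    _ ≤ (B ^ (-α)) ^ m * (B / (B ^ (-α) * B - 1) + 1 / (1 - B ^ (-α))) := by gcongr
    _ = (B / (B ^ (-α) * B - 1) + 1 / (1 - B ^ (-α))) * (B ^ (-α)) ^ m := mul_comm _ _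
    _ ≤ (B / (B ^ (-α) * B - 1) + 1 / (1 - B ^ (-α))) * s ^ α := by
        rw [rpow_eq_rpow_neg_pow_mul hB₀ α hs₀.le m]
        gcongr
        exact le_mul_of_one_le_right (by positivity) (Real.one_le_rpow hm hα₀.le)

end GeometricModulus

section Weierstrass

theorem exists_real_add_eq (x y : UnitAddCircle) : ∃ w : ℝ, |w| = dist x y ∧ x + w = y := by
  obtain ⟨t, ht⟩ := QuotientAddGroup.mk_surjective (y - x)
  have ht' : (t : UnitAddCircle) = y - x := ht
  refine ⟨t - round t, ?_, ?_⟩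
  · rw [dist_comm, dist_eq_norm, ← ht', UnitAddCircle.norm_eq]
  · have hround : ((round t : ℝ) : UnitAddCircle) = 0 :=
      (AddCircle.coe_eq_zero_iff 1).2 ⟨round t, by simp⟩
    rw [AddCircle.coe_sub, ht', hround, sub_zero, add_sub_cancel]

theorem add_dist_eq_or_add_dist_eq (x y : UnitAddCircle) :
    x + (dist x y : ℝ) = y ∨ y + (dist x y : ℝ) = x := by
  obtain ⟨w, hw, rfl⟩ := exists_real_add_eq x y
  rw [← hw]
  rcases abs_choice w with h | h <;> simp [h]

theorem unitAddCircle_dist_le_one (x y : UnitAddCircle) : dist x y ≤ 1 := by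
  rw [dist_eq_norm]
  refine (AddCircle.norm_le_half_period 1 one_ne_zero).trans ?_
  norm_num

theorem IsLipschitzOnCircle.continuous {g : UnitAddCircle → ℝ} (hg : IsLipschitzOnCircle g) :
    Continuous g :=
  hg.choose_spec.continuous

theorem dist_nsmul_le {E : Type*} [SeminormedAddCommGroup E] (n : ℕ) (x y : E) :
    dist (n • x) (n • y) ≤ n * dist x y := by
  rw [dist_eq_norm, ← nsmul_sub, dist_eq_norm]
  exact norm_nsmul_le

theorem isLipschitzOnCircle_sub_smul {h : UnitAddCircle → ℝ} (hh : IsLipschitzOnCircle h) (q : ℝ)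
    (b : ℕ) : IsLipschitzOnCircle fun x => h x - q * h (b • x) := by
  obtain ⟨K, hK⟩ := hh
  have hsmul : LipschitzWith b fun x : UnitAddCircle => b • x :=
    LipschitzWith.of_dist_le_mul (dist_nsmul_le b)
  exact ⟨_, hK.sub ((lipschitzWith_smul (β := ℝ) q).comp (hK.comp hsmul))⟩

variable {α : ℝ} {b : ℕ} {g : UnitAddCircle → ℝ}

theorem rpow_neg_lt_one_of_one_lt (hb : 1 < b) (hα : 0 < α) : (b : ℝ) ^ (-α) < 1 :=
  Real.rpow_lt_one_of_one_lt_of_neg (Nat.one_lt_cast.2 hb) (neg_lt_zero.2 hα)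

theorem hasSum_weierstrass (hb : 1 < b) (hα : 0 < α) (hg : Continuous g) (x : UnitAddCircle) :
    HasSum (fun k : ℕ => ((b : ℝ) ^ (-α)) ^ k * g (b ^ k • x)) (weierstrass α b g x) := by
  obtain ⟨M, hM⟩ := isCompact_univ.exists_bound_of_continuousOn hg.continuousOn
  simp only [weierstrass, ← neg_mul, Real.rpow_mul_natCast (Nat.cast_nonneg b)]
  refine (Summable.of_norm_bounded ((summable_geometric_of_lt_one (by positivity)
    (rpow_neg_lt_one_of_one_lt hb hα)).mul_right M) fun k => ?_).hasSum
  rw [norm_mul, Real.norm_of_nonneg (by positivity)]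
  exact mul_le_mul_of_nonneg_left (hM _ (Set.mem_univ _)) (by positivity)

theorem weierstrass_sub_smul (hb : 1 < b) (hα : 0 < α) (hg : Continuous g) :
    weierstrass α b (fun x => g x - (b : ℝ) ^ (-α) * g (b • x)) = g := by
  ext x
  have hsum := hasSum_weierstrass hb hα hg x
  have hcont : Continuous fun x => g x - (b : ℝ) ^ (-α) * g (b • x) := by fun_prop
  have hterm (k : ℕ) : ((b : ℝ) ^ (-α)) ^ k * (g (b ^ k • x) - (b : ℝ) ^ (-α) * g (b • b ^ k • x)) =
      ((b : ℝ) ^ (-α)) ^ k * g (b ^ k • x) -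
        ((b : ℝ) ^ (-α)) ^ (k + 1) * g (b ^ (k + 1) • x) := by
    rw [smul_smul, ← pow_succ', pow_succ ((b : ℝ) ^ (-α))]
    ring
  refine (hasSum_weierstrass hb hα hcont x).unique ?_
  simp only [hterm]
  have htelescope := hsum.sub ((hasSum_nat_add_iff' 1).2 hsum)
  rwa [sub_sub_cancel, Finset.sum_range_one, pow_zero, pow_zero, one_mul, one_smul] at htelescope

theorem abs_weierstrass_sub_le (hb : 1 < b) (hα : 0 < α) {K : NNReal} (hg : LipschitzWith K g)
    (x y : UnitAddCircle) : |weierstrass α b g x - weierstrass α b g y| ≤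
      K * geometricModulus ((b : ℝ) ^ (-α)) b (dist x y) := by
  have hmod := hasSum_geometricModulus (by positivity) (rpow_neg_lt_one_of_one_lt hb hα)
    b.cast_nonneg (dist_nonneg (x := x) (y := y))
  have hdiff := (hasSum_weierstrass hb hα hg.continuous x).sub
    (hasSum_weierstrass hb hα hg.continuous y)
  refine hdiff.norm_le_of_bounded (hmod.mul_left (K : ℝ)) fun k => ?_
  rw [← mul_sub, norm_mul, Real.norm_of_nonneg (by positivity), mul_left_comm, ← dist_eq_norm]
  gcongr
  refine (hg.dist_le_mul _ _).trans ?_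
  gcongr
  exact le_min (mod_cast dist_nsmul_le (b ^ k) x y) (unitAddCircle_dist_le_one _ _)

theorem exists_abs_weierstrass_sub_le (hb : 1 < b) (hα₀ : 0 < α) (hα₁ : α < 1)
    (hg : IsLipschitzOnCircle g) :
    ∃ C, ∀ x y, |weierstrass α b g x - weierstrass α b g y| ≤ C * dist x y ^ α := by
  obtain ⟨K, hK⟩ := hg
  obtain ⟨C, -, hC⟩ := exists_geometricModulus_le_mul_rpow (Nat.one_lt_cast.2 hb) hα₀ hα₁
  refine ⟨K * C, fun x y => ?_⟩
  rcases eq_or_ne x y with rfl | hxy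
  · simp [Real.zero_rpow hα₀.ne']
  calc |weierstrass α b g x - weierstrass α b g y|
      ≤ K * geometricModulus ((b : ℝ) ^ (-α)) b (dist x y) :=
        abs_weierstrass_sub_le hb hα₀ hK x y
    _ ≤ K * (C * dist x y ^ α) := by
        gcongr
        exact hC _ (dist_pos.2 hxy) (unitAddCircle_dist_le_one x y)
    _ = K * C * dist x y ^ α := (mul_assoc _ _ _).symm

theorem continuous_weierstrass (hb : 1 < b) (hα₀ : 0 < α) (hα₁ : α < 1)
    (hg : IsLipschitzOnCircle g) : Continuous (weierstrass α b g) :=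
  let ⟨_, hC⟩ := exists_abs_weierstrass_sub_le hb hα₀ hα₁ hg
  continuous_of_dist_le_mul_rpow hα₀ hC

theorem pow_mul_le_weierstrass_sub_add (hb : 1 < b) (hα : 0 < α) (hg : Continuous g)
    (hdrop : ∀ (x : UnitAddCircle) (s : ℝ), 0 ≤ s → g x - g (x + s) ≤ min s 1)
    (x : UnitAddCircle) {s : ℝ} (hs : 0 ≤ s) (m : ℕ) :
    ((b : ℝ) ^ (-α)) ^ m *
        (g (b ^ m • x + (b ^ m * s : ℝ)) - g (b ^ m • x) + min ((b : ℝ) ^ m * s) 1) ≤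
      weierstrass α b g (x + s) - weierstrass α b g x +
        geometricModulus ((b : ℝ) ^ (-α)) b s := by
  have hsmul (k : ℕ) : b ^ k • (x + (s : UnitAddCircle)) = b ^ k • x + (b ^ k * s : ℝ) := by
    rw [smul_add, ← AddCircle.coe_nsmul, nsmul_eq_mul, Nat.cast_pow]
  have hsum := ((hasSum_weierstrass hb hα hg (x + s)).sub (hasSum_weierstrass hb hα hg x)).add
    (hasSum_geometricModulus (by positivity) (rpow_neg_lt_one_of_one_lt hb hα) b.cast_nonneg hs)
  simp only [hsmul, ← mul_sub, ← mul_add] at hsum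
  refine le_hasSum hsum m fun k _ => mul_nonneg (by positivity) ?_
  linarith [hdrop (b ^ k • x) (b ^ k * s) (by positivity)]

end Weierstrass

section Sawtooth

theorem monotone_mul_floor_add {c : ℝ} {φ : ℝ → ℝ} (hφ : MonotoneOn φ (Set.Icc 0 1))
    (hφ₁ : φ 1 ≤ c + φ 0) : Monotone fun t : ℝ => c * ⌊t⌋ + φ (Int.fract t) := by
  have hfract (t : ℝ) : Int.fract t ∈ Set.Icc (0 : ℝ) 1 :=
    ⟨Int.fract_nonneg t, (Int.fract_lt_one t).le⟩
  have h0 : (0 : ℝ) ∈ Set.Icc (0 : ℝ) 1 := ⟨le_rfl, zero_le_one⟩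
  have h1 : (1 : ℝ) ∈ Set.Icc (0 : ℝ) 1 := ⟨zero_le_one, le_rfl⟩
  intro s t hst
  rcases (Int.floor_mono hst).eq_or_lt with hfloor | hfloor
  · have : Int.fract s ≤ Int.fract t := by
      rw [Int.fract, Int.fract, hfloor]
      exact sub_le_sub_right hst _
    simpa only [hfloor, add_le_add_iff_left] using hφ (hfract s) (hfract t) this
  · have hc : 0 ≤ c := by linarith [hφ h0 h1 zero_le_one]
    have hfloor' : (⌊s⌋ : ℝ) + 1 ≤ ⌊t⌋ := by exact_mod_cast hfloor
    calc c * ⌊s⌋ + φ (Int.fract s)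
        ≤ c * ⌊s⌋ + (c + φ 0) := by
          gcongr
          exact (hφ (hfract s) h1 (Int.fract_lt_one s).le).trans hφ₁
      _ = c * (⌊s⌋ + 1) + φ 0 := by ring
      _ ≤ c * ⌊t⌋ + φ (Int.fract t) := by
          gcongr
          exact hφ h0 (hfract t) (Int.fract_nonneg t)

/-- The continuous staircase which, on each interval `[n, n + 1]`, climbs from `n` to `n + 1` with
slope `L` and then stays flat. -/
noncomputable def staircase (L t : ℝ) : ℝ := ⌊t⌋ + min 1 (L * Int.fract t)

variable {L : ℝ}

theorem monotone_staircase (hL : 0 ≤ L) : Monotone (staircase L) := by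
  have := monotone_mul_floor_add (c := 1) (φ := fun u => min 1 (L * u))
    (fun u _ v _ huv => min_le_min_left 1 (mul_le_mul_of_nonneg_left huv hL)) (by simp)
  unfold staircase
  simpa only [one_mul] using this

theorem monotone_mul_sub_staircase (hL : 1 ≤ L) : Monotone fun t => L * t - staircase L t := by
  have hmono := monotone_mul_floor_add (c := L - 1) (φ := fun u => max (L * u - 1) 0)
    (fun u _ v _ huv => max_le_max_right 0 <|
      sub_le_sub_right (mul_le_mul_of_nonneg_left huv (zero_le_one.trans hL)) 1) (by simp [hL])
  convert hmono using 2 with t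
  have hmin : min 1 (L * Int.fract t) = L * Int.fract t - max (L * Int.fract t - 1) 0 := by
    rw [← min_sub_sub_left, sub_sub_cancel, sub_zero]
  rw [staircase, hmin]
  linear_combination -L * Int.floor_add_fract t

theorem staircase_zero (L : ℝ) : staircase L 0 = 0 := by simp [staircase]

theorem staircase_inv (hL : 1 < L) : staircase L L⁻¹ = 1 := by
  have hL₀ : 0 < L := one_pos.trans hL
  have hfract : Int.fract L⁻¹ = L⁻¹ :=
    Int.fract_eq_self.2 ⟨inv_nonneg.2 hL₀.le, inv_lt_one_of_one_lt₀ hL⟩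
  have hfloor : ⌊L⁻¹⌋ = 0 := Int.floor_eq_zero_iff.2 ⟨inv_nonneg.2 hL₀.le, inv_lt_one_of_one_lt₀ hL⟩
  simp [staircase, hfract, hfloor, hL₀.ne']

theorem staircase_sub_self_mem_Icc (hL : 1 ≤ L) (t : ℝ) :
    staircase L t - t ∈ Set.Icc (0 : ℝ) 1 := by
  have hfract := Int.fract_nonneg t
  have hfract' := (Int.fract_lt_one t).le
  have hself : staircase L t - t = min 1 (L * Int.fract t) - Int.fract t := by
    rw [staircase]
    linear_combination Int.floor_add_fract t
  rw [hself]
  exact ⟨sub_nonneg.2 (le_min hfract' (le_mul_of_one_le_left hfract hL)),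
    by linarith [min_le_left 1 (L * Int.fract t)]⟩

theorem periodic_staircase_sub_self (L : ℝ) :
    Function.Periodic (fun t => staircase L t - t) 1 := fun t => by
  simp only [staircase, Int.floor_add_one, Int.fract_add_one]
  push_cast
  ring

/-- The sawtooth on the circle which, for `1 < L`, rises steeply from `0` with slope `L - 1` up to
the point `L⁻¹` and then falls back to `0` with slope `-1`. Its value at a point of `ℝ / ℤ` is the
height of the staircase above the diagonal. -/
noncomputable def sawtooth (L : ℝ) : UnitAddCircle → ℝ :=
  (periodic_staircase_sub_self L).lift

theorem sawtooth_coe (L t : ℝ) : sawtooth L (t : UnitAddCircle) = staircase L t - t := rfl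

theorem sawtooth_mem_Icc (hL : 1 ≤ L) (x : UnitAddCircle) : sawtooth L x ∈ Set.Icc (0 : ℝ) 1 := by
  induction x using QuotientAddGroup.induction_on with
  | H t => exact staircase_sub_self_mem_Icc hL t

theorem sawtooth_sub_add_le (hL : 1 ≤ L) (x : UnitAddCircle) {s : ℝ} (hs : 0 ≤ s) :
    sawtooth L x - sawtooth L (x + s) ≤ min s 1 := by
  refine le_min ?_ (by linarith [(sawtooth_mem_Icc hL x).2, (sawtooth_mem_Icc hL (x + s)).1])
  induction x using QuotientAddGroup.induction_on with
  | H t =>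
    change staircase L t - t - (staircase L (t + s) - (t + s)) ≤ s
    linarith [monotone_staircase (zero_le_one.trans hL) (le_add_of_nonneg_right (a := t) hs)]

theorem sawtooth_add_sub_le (hL : 1 ≤ L) (x : UnitAddCircle) {s : ℝ} (hs : 0 ≤ s) :
    sawtooth L (x + s) - sawtooth L x ≤ (L - 1) * s := by
  induction x using QuotientAddGroup.induction_on with
  | H t =>
    change staircase L (t + s) - (t + s) - (staircase L t - t) ≤ (L - 1) * s
    linarith [monotone_mul_sub_staircase hL (le_add_of_nonneg_right (a := t) hs)]

theorem isLipschitzOnCircle_sawtooth_sub (hL : 1 ≤ L) (p : UnitAddCircle) :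
    IsLipschitzOnCircle fun x => sawtooth L (x - p) := by
  have hforward (x : UnitAddCircle) {s : ℝ} (hs : 0 ≤ s) :
      |sawtooth L (x + s) - sawtooth L x| ≤ L * s := by
    have hdrop := (sawtooth_sub_add_le hL x hs).trans (min_le_left _ _)
    have hrise := sawtooth_add_sub_le hL x hs
    rw [abs_le]
    constructor <;> nlinarith
  have hsaw : LipschitzWith ⟨L, zero_le_one.trans hL⟩ (sawtooth L) :=
    LipschitzWith.of_dist_le_mul fun x y => by
      rcases add_dist_eq_or_add_dist_eq x y with h | h
      · rw [dist_comm (sawtooth L x)]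
        exact (congrArg (fun z => |sawtooth L z - sawtooth L x|) h).ge.trans
          (hforward x dist_nonneg)
      · exact (congrArg (fun z => |sawtooth L z - sawtooth L y|) h).ge.trans
          (hforward y dist_nonneg)
  exact ⟨_, hsaw.comp (LipschitzWith.id.sub (LipschitzWith.const p))⟩

theorem one_sub_le_sawtooth_sub_sub (hL : 1 < L) {u v : ℝ} (hv : 0 ≤ v) (huv : v + L⁻¹ ≤ u)
    (x : UnitAddCircle) :
    1 - u ≤ sawtooth L (x + u - (x + v)) - sawtooth L (x - (x + v)) := by
  have hmono := monotone_staircase (zero_le_one.trans hL.le)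
  have htop : 1 ≤ staircase L (u - v) := staircase_inv hL ▸ hmono (by linarith)
  have hbot : staircase L (-v) ≤ 0 := staircase_zero L ▸ hmono (neg_nonpos.2 hv)
  rw [add_sub_add_left_eq_sub, sub_add_cancel_left, ← AddCircle.coe_sub, ← AddCircle.coe_neg,
    sawtooth_coe, sawtooth_coe]
  linarith

theorem rpow_div_two_le_weierstrass_sawtooth_sub {b : ℕ} {α : ℝ} (hb : 1 < b) (hα : 0 < α)
    (hL : 1 < L) {x : UnitAddCircle} {s v : ℝ} {m : ℕ} (hs : 0 ≤ s) (hv : 0 ≤ v)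
    (hvs : v + L⁻¹ ≤ b ^ m * s) (hms : (b : ℝ) ^ m * s ≤ 1)
    (hmod : geometricModulus ((b : ℝ) ^ (-α)) b s ≤ 1 / 2 * ((b : ℝ) ^ (-α)) ^ m) :
    s ^ α / 2 ≤ weierstrass α b (fun z => sawtooth L (z - (b ^ m • x + v))) (x + s) -
      weierstrass α b (fun z => sawtooth L (z - (b ^ m • x + v))) x := by
  have hb₀ : (0 : ℝ) < b := by positivity
  have hcont := (isLipschitzOnCircle_sawtooth_sub hL.le (b ^ m • x + v)).continuous
  have hdrop (z : UnitAddCircle) (t : ℝ) (ht : 0 ≤ t) :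
      sawtooth L (z - (b ^ m • x + v)) - sawtooth L (z + t - (b ^ m • x + v)) ≤ min t 1 := by
    rw [add_sub_right_comm]
    exact sawtooth_sub_add_le hL.le _ ht
  have hrise := one_sub_le_sawtooth_sub_sub hL hv hvs (b ^ m • x)
  have hpow : s ^ α ≤ ((b : ℝ) ^ (-α)) ^ m := by
    rw [rpow_eq_rpow_neg_pow_mul hb₀ α hs m]
    exact mul_le_of_le_one_right (by positivity) (Real.rpow_le_one (by positivity) hms hα.le)
  have hscale : ((b : ℝ) ^ (-α)) ^ m ≤ _ :=
    (le_mul_of_one_le_right (by positivity) (by rw [min_eq_left hms]; linarith)).trans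
      (pow_mul_le_weierstrass_sub_add hb hα hcont hdrop x hs m)
  linarith

end Sawtooth

section Separation

theorem exists_finite_net {X : Type*} [PseudoMetricSpace X] [CompactSpace X] {ε : ℝ} (hε : 0 < ε) :
    ∃ P : Set X, P.Finite ∧ ∀ x, ∃ p ∈ P, dist x p ≤ ε := by
  obtain ⟨P, -, hP, hcover⟩ := finite_cover_balls_of_compact (isCompact_univ (X := X)) hε
  refine ⟨P, hP, fun x => ?_⟩
  obtain ⟨p, hp, hxp⟩ := Set.mem_iUnion₂.1 (hcover (Set.mem_univ x))
  exact ⟨p, hp, (Metric.mem_ball.1 hxp).le⟩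

variable {α : ℝ} {b : ℕ}

theorem exists_finite_separating_of_dist_le (hb : 1 < b) (hα₀ : 0 < α) (hα₁ : α < 1) :
    ∃ ρ > 0, ∃ S : Set (UnitAddCircle → ℝ), S.Finite ∧ (∀ g ∈ S, IsLipschitzOnCircle g) ∧
      ∀ x y, x ≠ y → dist x y ≤ ρ →
        ∃ g ∈ S, dist x y ^ α / 2 ≤ |weierstrass α b g x - weierstrass α b g y| := by
  have hb₁ : (1 : ℝ) < b := Nat.one_lt_cast.2 hb
  obtain ⟨δ, hδ, hmod⟩ := exists_geometricModulus_le_mul_pow (q := (b : ℝ) ^ (-α)) (by positivity)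
    (rpow_neg_lt_one_of_one_lt hb hα₀) b.cast_nonneg (one_lt_rpow_neg_mul_self hb₁ hα₁) one_half_pos
  obtain ⟨L, hL⟩ := exists_gt (max (2 * b : ℝ) (2 * b / δ))
  have hLb : 2 * (b : ℝ) < L := (le_max_left _ _).trans_lt hL
  have hLδ : 2 * (b : ℝ) / δ < L := (le_max_right _ _).trans_lt hL
  have hL₁ : 1 < L := by linarith
  obtain ⟨P, hP, hnet⟩ := exists_finite_net (X := UnitAddCircle) (by positivity : 0 < L⁻¹ / 2)
  refine ⟨2 * L⁻¹, by positivity, (fun p x => sawtooth L (x - p)) '' P, hP.image _, ?_, ?_⟩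
  · rintro - ⟨p, -, rfl⟩
    exact isLipschitzOnCircle_sawtooth_sub hL₁.le p
  have hsep (x : UnitAddCircle) (s : ℝ) (hs : 0 < s) (hsL : s ≤ 2 * L⁻¹) :
      ∃ g ∈ (fun p x => sawtooth L (x - p)) '' P,
        s ^ α / 2 ≤ weierstrass α b g (x + s) - weierstrass α b g x := by
    obtain ⟨m, hm, hm'⟩ := exists_le_pow_mul_le hb₁ hs hsL
    obtain ⟨p, hp, hdist⟩ := hnet (b ^ m • x + ((b ^ m * s - L⁻¹) / 2 : ℝ))
    obtain ⟨w, hw, rfl⟩ := exists_real_add_eq (b ^ m • x + ((b ^ m * s - L⁻¹) / 2 : ℝ)) p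
    have hwL := abs_le.1 (hw.trans_le hdist)
    have hmL : (b : ℝ) ^ m * s ≤ 2 * b / L := hm'.trans_eq (by ring)
    have hms : (b : ℝ) ^ m * s ≤ 1 := hmL.trans ((div_le_one (by positivity)).2 hLb.le)
    have hmδ : (b : ℝ) ^ m * s ≤ δ := hmL.trans ((div_le_comm₀ hδ (by positivity)).1 hLδ.le)
    refine ⟨_, Set.mem_image_of_mem _ hp, ?_⟩
    simp only [add_assoc, ← AddCircle.coe_add]
    exact rpow_div_two_le_weierstrass_sawtooth_sub hb hα₀ hL₁ hs.le (by linarith) (by linarith)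
      hms (hmod m s hs.le hmδ)
  intro x y hxy hρ
  rcases add_dist_eq_or_add_dist_eq x y with h | h
  · obtain ⟨g, hg, hle⟩ := hsep x _ (dist_pos.2 hxy) hρ
    rw [h] at hle
    exact ⟨g, hg, hle.trans (abs_sub_comm (weierstrass α b g x) _ ▸ le_abs_self _)⟩
  · obtain ⟨g, hg, hle⟩ := hsep y _ (dist_pos.2 hxy) hρ
    rw [h] at hle
    exact ⟨g, hg, hle.trans (le_abs_self _)⟩

theorem exists_finite_separating_of_le_dist (hb : 1 < b) (hα : 0 < α) {ρ : ℝ} (hρ : 0 < ρ) :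
    ∃ S : Set (UnitAddCircle → ℝ), S.Finite ∧ (∀ g ∈ S, IsLipschitzOnCircle g) ∧
      ∀ x y, ρ ≤ dist x y → ∃ g ∈ S, ρ / 2 ≤ |weierstrass α b g x - weierstrass α b g y| := by
  obtain ⟨P, hP, hnet⟩ := exists_finite_net (X := UnitAddCircle) (by positivity : 0 < ρ / 4)
  let g (p x : UnitAddCircle) : ℝ := dist x p - (b : ℝ) ^ (-α) * dist (b • x) p
  have hdist (p : UnitAddCircle) : IsLipschitzOnCircle (dist · p) := ⟨1, LipschitzWith.dist_left p⟩
  have hg (p : UnitAddCircle) : weierstrass α b (g p) = (dist · p) :=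
    weierstrass_sub_smul hb hα (hdist p).continuous
  refine ⟨g '' P, hP.image _, ?_, fun x y hxy => ?_⟩
  · rintro - ⟨p, -, rfl⟩
    exact isLipschitzOnCircle_sub_smul (hdist p) _ b
  · obtain ⟨p, hp, hxp⟩ := hnet x
    refine ⟨g p, Set.mem_image_of_mem g hp, ?_⟩
    rw [hg, abs_sub_comm]
    refine le_trans ?_ (le_abs_self _)
    linarith [dist_triangle_right x y p]

theorem exists_finite_separating (hb : 1 < b) (hα₀ : 0 < α) (hα₁ : α < 1) :
    ∃ c > 0, ∃ S : Set (UnitAddCircle → ℝ), S.Finite ∧ (∀ g ∈ S, IsLipschitzOnCircle g) ∧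
      ∀ x y, x ≠ y → ∃ g ∈ S, c * dist x y ^ α ≤ |weierstrass α b g x - weierstrass α b g y| := by
  obtain ⟨ρ, hρ, S, hS, hSlip, hnear⟩ := exists_finite_separating_of_dist_le hb hα₀ hα₁
  obtain ⟨T, hT, hTlip, hfar⟩ := exists_finite_separating_of_le_dist hb hα₀ hρ
  refine ⟨min (1 / 2) (ρ / 2), by positivity, S ∪ T, hS.union hT,
    fun g hg => hg.elim (hSlip g) (hTlip g), fun x y hxy => ?_⟩
  rcases le_total (dist x y) ρ with hdist | hdist
  · obtain ⟨g, hg, hle⟩ := hnear x y hxy hdist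
    refine ⟨g, .inl hg, le_trans ?_ hle⟩
    exact (mul_le_mul_of_nonneg_right (min_le_left _ _) (Real.rpow_nonneg dist_nonneg α)).trans_eq
      (one_div_mul_eq_div _ _)
  · obtain ⟨g, hg, hle⟩ := hfar x y hdist
    refine ⟨g, .inr hg, le_trans ?_ hle⟩
    exact mul_le_of_le_one_right (by positivity) (Real.rpow_le_one dist_nonneg
      (unitAddCircle_dist_le_one x y) hα₀.le) |>.trans (min_le_right _ _)

theorem isBiHolder_weierstrassEmbedding (hb : 1 < b) (hα₀ : 0 < α) (hα₁ : α < 1) {d : ℕ}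
    {G : Fin d → UnitAddCircle → ℝ} (hG : ∀ i, IsLipschitzOnCircle (G i)) {c : ℝ} (hc : 0 < c)
    (hsep : ∀ x y, x ≠ y → ∃ i,
      c * dist x y ^ α ≤ |weierstrass α b (G i) x - weierstrass α b (G i) y|) :
    IsBiHolder α (weierstrassEmbedding α b G) := by
  choose C hC using fun i => exists_abs_weierstrass_sub_le hb hα₀ hα₁ (hG i)
  refine ⟨c, ∑ i, |C i| + 1, hc, by positivity, fun x y hxy => ?_⟩
  have hpos : 0 < dist x y ^ α := Real.rpow_pos_of_pos (dist_pos.2 hxy) α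
  rw [le_div_iff₀ hpos, div_le_iff₀ hpos]
  constructor
  · obtain ⟨i, hi⟩ := hsep x y hxy
    exact hi.trans (norm_le_pi_norm (weierstrassEmbedding α b G x - weierstrassEmbedding α b G y) i)
  · refine (pi_norm_le_iff_of_nonneg (by positivity)).2 fun i => (hC i x y).trans ?_
    gcongr
    linarith [le_abs_self (C i),
      Finset.single_le_sum (fun j _ => abs_nonneg (C j)) (Finset.mem_univ i)]

theorem exists_isBiHolder_weierstrassEmbedding (hb : 1 < b) (hα₀ : 0 < α) (hα₁ : α < 1) :
    ∃ (d : ℕ) (G : Fin d → UnitAddCircle → ℝ),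
      (∀ i, IsLipschitzOnCircle (G i)) ∧ IsBiHolder α (weierstrassEmbedding α b G) := by
  obtain ⟨c, hc, S, hS, hlip, hsep⟩ := exists_finite_separating hb hα₀ hα₁
  obtain ⟨d, G, -, rfl⟩ := hS.fin_param
  have hG (i : Fin d) : IsLipschitzOnCircle (G i) := hlip (G i) (Set.mem_range_self i)
  refine ⟨d, G, hG, isBiHolder_weierstrassEmbedding hb hα₀ hα₁ hG hc fun x y hxy => ?_⟩
  obtain ⟨-, ⟨i, rfl⟩, hi⟩ := hsep x y hxy
  exact ⟨i, hi⟩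

end Separation

theorem theorem3p1_general (b : ℕ) (hb : 2 ≤ b) (α : ℝ) (hα₀ : 0 < α) (hα₁ : α < 1) :
    (∃ (d : ℕ) (G : Fin d → UnitAddCircle → ℝ),
        (∀ i, IsLipschitzOnCircle (G i)) ∧ IsBiHolder α (weierstrassEmbedding α b G)) ∧
    (∀ (d : ℕ) (Φ : UnitAddCircle → Fin d → ℝ), IsBiHolder α Φ →
        ∀ W : UnitAddCircle → ℝ, Measurable W →
          ∀ᵐ t : Fin d → ℝ, IsACWithL2Density (occupationMeasure (perturbed W Φ t))) :=
  ⟨exists_isBiHolder_weierstrassEmbedding hb hα₀ hα₁,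
    fun _ _ hΦ _ hW => hΦ.ae_isACWithL2Density hα₀ hα₁ hW⟩

theorem theorem3p1 (b : ℕ) (hb : 2 ≤ b) (α : ℝ) (hα₀ : 0 < α) (hα₁ : α < 1) :
    (∃ (d : ℕ) (G : Fin d → UnitAddCircle → ℝ),
        (∀ i, IsLipschitzOnCircle (G i)) ∧ IsBiHolder α (weierstrassEmbedding α b G)) ∧
    (∀ (d : ℕ) (G : Fin d → UnitAddCircle → ℝ),
        (∀ i, IsLipschitzOnCircle (G i)) → IsBiHolder α (weierstrassEmbedding α b G) →
        ∀ W ∈ weierstrassFamily α b,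
          ∀ᵐ t : Fin d → ℝ ∂MeasureTheory.volume,
            IsACWithL2Density
              (occupationMeasure (perturbed W (weierstrassEmbedding α b G) t))) := by
  obtain ⟨hexists, hae⟩ := theorem3p1_general b hb α hα₀ hα₁
  refine ⟨hexists, fun d G _ hG W hW => hae d _ hG W ?_⟩
  obtain ⟨g, hg, rfl⟩ := hW
  exact (continuous_weierstrass hb hα₀ hα₁ hg).measurable
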